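/- Let $A$ be a finite alphabet and let $\mathcal E$ be the set of all stationary ergodic processes over $A$, i.e. of probability measures $\mu$ on $A^{\infty}$ (with the product sigma-algebra) such that the segments $X_{1..k}$ and $X_{i..i+k-1}$ have the same distribution for all $i,k\ge 1$ and such that, for every $k\ge1$ and $B\subseteq A^k$, the frequency $\frac1{n-k+1}\#\{i\le n-k+1: X_{i..i+k-1}\in B\}$ converges $\mu$-almost surely to a constant as $n\to\infty$. For processes $\mu_1,\mu_2$ let $$d(\mu_1,\mu_2)=\sum_{k=1}^\infty \frac1{k(k+1)}\sum_{w\in A^k}\bigl|\mu_1(X_{1..k}=w)-\mu_2(X_{1..k}=w)\bigr|$$ be the distributional distance. A test is a function $\varphi:\bigcup_{n}A^n\to\{0,1\}$; it is uniformly consistent for $H_0$ against $H_1$ (where $H_0,H_1\subseteq\mathcal E$) if for every $\alpha>0$ there is $n_\alpha\in\mathbb N$ such that for every $n\ge n_\alpha$ and every $i\in\{0,1\}$ one has $\mu(\varphi(X_{1..n})=i)<\alpha$ for every $\mu\in H_{1-i}$. Let $\rho,\nu\in\mathcal E$ with $\rho\ne\nu$ and let $\varepsilon>0$. Then there is no uniformly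 consistent test for $H_0=\{\rho\}$ against $H_1=\{\nu'\in\mathcal E: d(\nu',\nu)\le\varepsilon\}$. -/

import Mathlib

open MeasureTheory Filter Topology

namespace StationaryProcess

variable {A : Type*}

/-- The segment `(x_i, …, x_{i+k-1})` of length `k` of an infinite sequence (time starts at `0`). -/
def window (i k : ℕ) (x : ℕ → A) : Fin k → A := fun t => x (i + t)

/-- The frequency with which the sample `x` of length `n` falls in the set `B ⊆ A^k`:
the proportion of the `n - k + 1` windows of length `k` that belong to `B`, and `0` if `n < k`. -/
noncomputable def freq {n k : ℕ} (x : Fin n → A) (B : Set (Fin k → A)) : ℝ :=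
  if h : k ≤ n then
    (∑ i : Fin (n - k + 1),
      B.indicator (fun _ => (1 : ℝ)) (fun t : Fin k => x ⟨i + t, by omega⟩)) / ((n - k + 1 : ℕ) : ℝ)
  else 0

/-- A process (a probability measure on one-sided sequences) is stationary if all the segments
of the same length have the same distribution. -/
def IsStationary [MeasurableSpace A] (ρ : ProbabilityMeasure (ℕ → A)) : Prop :=
  ∀ (i k : ℕ) (B : Set (Fin k → A)), MeasurableSet B →
    (ρ : Measure (ℕ → A)) {x | window 0 k x ∈ B} = (ρ : Measure (ℕ → A)) {x | window i k x ∈ B}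

/-- A process is ergodic if the frequency of every finite-time event converges almost surely
to a constant. -/
def IsErgodic [MeasurableSpace A] (ρ : ProbabilityMeasure (ℕ → A)) : Prop :=
  ∀ (k : ℕ) (B : Set (Fin k → A)), MeasurableSet B →
    ∃ v : ℝ, ∀ᵐ x ∂(ρ : Measure (ℕ → A)),
      Tendsto (fun n : ℕ => freq (window 0 n x) B) atTop (𝓝 v)

/-- The set `ℰ` of all stationary ergodic processes with alphabet `A`. -/
def stationaryErgodic (A : Type*) [MeasurableSpace A] : Set (ProbabilityMeasure (ℕ → A)) :=
  {ρ | IsStationary ρ ∧ IsErgodic ρ}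

/-- The sum `∑_{w ∈ A^k} |ρ₁(w) - ρ₂(w)|` over words `w` of length `k`, where `ρ(w)` is the
probability that the process starts with `w`. -/
noncomputable def wordDist [Fintype A] [MeasurableSpace A]
    (ρ₁ ρ₂ : ProbabilityMeasure (ℕ → A)) (k : ℕ) : ℝ :=
  ∑ w : Fin k → A, |(ρ₁ : Measure (ℕ → A)).real {x | window 0 k x = w} -
    (ρ₂ : Measure (ℕ → A)).real {x | window 0 k x = w}|

/-- The distributional distance `∑_{k ≥ 1} w_k ∑_{w ∈ A^k} |ρ₁(w) - ρ₂(w)|` with the weights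
`w_k = 1 / (k (k + 1))`; the summation index below is `k - 1`. -/
noncomputable def distDistance [Fintype A] [MeasurableSpace A]
    (ρ₁ ρ₂ : ProbabilityMeasure (ℕ → A)) : ℝ :=
  ∑' j : ℕ, 1 / (((j : ℝ) + 1) * ((j : ℝ) + 2)) * wordDist ρ₁ ρ₂ (j + 1)

/-- A test: a function that gives, for a sample of any size `n`, the answer `0` or `1`. -/
abbrev Test (A : Type*) : Type _ := (n : ℕ) → (Fin n → A) → Fin 2

/-- Uniform consistency of a test of `H₀` against `H₁`: for every `α > 0`, from some sample size
on, the probability of error is less than `α` for every process in `H₀` (where the answer `1` is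
an error) and every process in `H₁` (where the answer `0` is an error). -/
def UniformlyConsistent [MeasurableSpace A] (φ : Test A)
    (H₀ H₁ : Set (ProbabilityMeasure (ℕ → A))) : Prop :=
  ∀ α : ℝ, 0 < α → ∃ N : ℕ, ∀ n : ℕ, N ≤ n →
    (∀ μ ∈ H₀, (μ : Measure (ℕ → A)).real {x | φ n (window 0 n x) = 1} < α) ∧
    (∀ μ ∈ H₁, (μ : Measure (ℕ → A)).real {x | φ n (window 0 n x) = 0} < α)

end StationaryProcess

namespace StationaryProcess

/-! ### Cesàro averages along residue classes. -/

section Cesaro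

/-! Every neighbourhood of `ν` contains ergodic processes that a sample of size `n` cannot separate
well from `ρ`. The mixture `(1 - δ) ν + δ ρ` is stationary and close to `ν`, but in general not
ergodic. Cutting it into independent blocks of length `L`, glued together from a uniformly random
phase, restores ergodicity, and for large `L` hardly changes the law of short words; long words
carry little weight in the distance. The resulting process `p` gives each event on the first `n`
letters at least a fraction of its `ρ`-probability, where the fraction depends on `ε` but not on `n`
(`exists_ergodic_near`). A test that answers `0` under `ρ` with probability above `1/2` therefore
errs under `p` with probability bounded away from zero at every sample size. -/

theorem tendsto_average_of_residues {a : ℕ → ℝ} (h0 : ∀ i, 0 ≤ a i) (h1 : ∀ i, a i ≤ 1)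
    {M : ℕ} (hM : 0 < M) {c : ℕ → ℝ}
    (hc : ∀ m < M, Tendsto (fun Q : ℕ => (∑ q ∈ Finset.range Q, a (m + q * M)) / (Q : ℝ))
      atTop (𝓝 (c m))) :
    Tendsto (fun N : ℕ => (∑ i ∈ Finset.range N, a i) / (N : ℝ)) atTop
      (𝓝 ((∑ m ∈ Finset.range M, c m) / M)) := by
  have hsplit : ∀ Q : ℕ, ∑ i ∈ Finset.range (Q * M), a i
      = ∑ m ∈ Finset.range M, ∑ q ∈ Finset.range Q, a (m + q * M) := by
    intro Q
    induction Q with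
    | zero => simp
    | succ Q ih =>
      simp only [Finset.sum_range_succ, Finset.sum_add_distrib]
      rw [← ih, add_mul, one_mul, Finset.sum_range_add]
      simp only [add_comm]
  have hMR : (0 : ℝ) < M := by exact_mod_cast hM
  have hQ : Tendsto (fun N : ℕ => N / M) atTop atTop := by
    refine tendsto_atTop.2 fun b => ?_
    filter_upwards [eventually_ge_atTop (b * M)] with N hN
    exact (Nat.le_div_iff_mul_le hM).2 hN
  have hratio : Tendsto (fun N : ℕ => ((N / M : ℕ) : ℝ) / (N : ℝ)) atTop (𝓝 ((M : ℝ)⁻¹)) := by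
    have h := (tendsto_nat_floor_mul_div_atTop (R := ℝ) (inv_nonneg.2 hMR.le)).comp
      tendsto_natCast_atTop_atTop
    refine h.congr fun N => ?_
    simp only [Function.comp]
    rw [← Nat.floor_div_eq_div (K := ℝ) N M, inv_mul_eq_div]
  have hmain : Tendsto (fun N : ℕ => (∑ i ∈ Finset.range (N / M * M), a i) / ((N / M : ℕ) : ℝ)
      * (((N / M : ℕ) : ℝ) / (N : ℝ))) atTop (𝓝 ((∑ m ∈ Finset.range M, c m) * (M : ℝ)⁻¹)) := by
    refine Tendsto.mul ?_ hratio
    have h : Tendsto (fun Q : ℕ => (∑ i ∈ Finset.range (Q * M), a i) / (Q : ℝ)) atTop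
        (𝓝 (∑ m ∈ Finset.range M, c m)) := by
      refine (tendsto_finsetSum _ fun m hm => hc m (Finset.mem_range.1 hm)).congr fun Q => ?_
      rw [hsplit, Finset.sum_div]
    exact h.comp hQ
  -- The incomplete last period has fewer than `M` terms, each in `[0, 1]`.
  have hrem : Tendsto (fun N : ℕ => (∑ i ∈ Finset.range (N % M), a (N / M * M + i)) / (N : ℝ))
      atTop (𝓝 0) := by
    refine squeeze_zero (fun N => div_nonneg (Finset.sum_nonneg fun i _ => h0 _) (by positivity))
      (fun N => ?_) (tendsto_const_div_atTop_nhds_zero_nat (M : ℝ))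
    gcongr
    calc ∑ i ∈ Finset.range (N % M), a (N / M * M + i)
        ≤ ∑ i ∈ Finset.range (N % M), (1 : ℝ) := Finset.sum_le_sum fun i _ => h1 _
      _ = ((N % M : ℕ) : ℝ) := by simp
      _ ≤ M := by exact_mod_cast (Nat.mod_lt N hM).le
  have h := hmain.add hrem
  rw [add_zero, ← div_eq_mul_inv] at h
  refine h.congr' ?_
  filter_upwards [eventually_ge_atTop M] with N hN
  have hq : ((N / M : ℕ) : ℝ) ≠ 0 := by
    have := Nat.div_pos hN hM
    positivity
  rw [div_mul_div_cancel₀ hq, ← add_div, ← Finset.sum_range_add, Nat.div_add_mod']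

/-- Used both for stationarity and to make the limiting frequency independent of the phase. -/
theorem sum_range_add_eq_of_periodic {g : ℕ → ℝ} {L : ℕ} (hg : ∀ m, g (m + L) = g m) (i : ℕ) :
    ∑ u ∈ Finset.range L, g (u + i) = ∑ u ∈ Finset.range L, g u := by
  induction i with
  | zero => rfl
  | succ i ih =>
    have h1 := Finset.sum_range_succ' (fun u => g (u + i)) L
    rw [Finset.sum_range_succ, add_comm L i, hg, zero_add] at h1
    rw [← ih, add_right_cancel h1]
    exact Finset.sum_congr rfl fun u _ => by rw [add_assoc, add_comm 1 i]

end Cesaro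

/-! ### Independent blocks with random phase: stationarity and ergodicity. -/

section BlockProcess

variable {A : Type*}

/-- The concatenation of the initial segments of length `L` of the sequences `ω 0, ω 1, …`. -/
def concat (L : ℕ) (ω : ℕ → ℕ → A) : ℕ → A := fun i => ω (i / L) (i % L)

theorem window_shift (u i k : ℕ) (y : ℕ → A) :
    window i k (fun j => y (j + u)) = window (u + i) k y := by
  funext t
  simp only [window]
  congr 1
  omega

theorem window_concat_add_mul {L : ℕ} (hL : 0 < L) (m s k : ℕ) (ω : ℕ → ℕ → A) :
    window (m + s * L) k (concat L ω) = window m k (concat L fun j => ω (j + s)) := by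
  funext t
  simp only [window, concat]
  rw [show m + s * L + (t : ℕ) = m + t + s * L by ring, Nat.add_mul_div_right _ _ hL,
    Nat.add_mul_mod_self_right]

theorem freq_window (x : ℕ → A) {n k : ℕ} (h : k ≤ n) (B : Set (Fin k → A)) :
    freq (window 0 n x) B = (∑ i ∈ Finset.range (n - k + 1),
      B.indicator (fun _ => (1 : ℝ)) (window i k x)) / ((n - k + 1 : ℕ) : ℝ) := by
  rw [freq, dif_pos h, Finset.sum_range]
  congr 1
  refine Finset.sum_congr rfl fun i _ => ?_
  congr 1
  funext t
  simp [window]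

variable [MeasurableSpace A]

theorem measurable_window (i k : ℕ) : Measurable (window (A := A) i k) :=
  measurable_pi_lambda _ fun _ => measurable_pi_apply _

theorem measurable_concat (L : ℕ) : Measurable (concat (A := A) L) :=
  measurable_pi_lambda _ fun i =>
    (measurable_pi_apply (i % L)).comp (measurable_pi_apply (i / L))

theorem measurable_shift (u : ℕ) : Measurable fun (y : ℕ → A) j => y (j + u) :=
  measurable_pi_lambda _ fun _ => measurable_pi_apply _

/-- The law of an independent sequence of copies of a process. -/
noncomputable def iidLaw (μ : ProbabilityMeasure (ℕ → A)) : Measure (ℕ → ℕ → A) :=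
  Measure.infinitePi fun _ => (μ : Measure (ℕ → A))

instance (μ : ProbabilityMeasure (ℕ → A)) : IsProbabilityMeasure (iidLaw μ) := by
  unfold iidLaw; infer_instance

theorem iIndepFun_eval_iidLaw (μ : ProbabilityMeasure (ℕ → A)) :
    ProbabilityTheory.iIndepFun (fun (j : ℕ) (ω : ℕ → ℕ → A) => ω j) (iidLaw μ) := by
  rw [ProbabilityTheory.iIndepFun_iff_map_fun_eq_infinitePi_map (by fun_prop)]
  simp only [iidLaw, Measure.infinitePi_map_eval]
  exact Measure.map_id

theorem measurePreserving_shift_iidLaw (μ : ProbabilityMeasure (ℕ → A)) (s : ℕ) :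
    MeasurePreserving (fun (ω : ℕ → ℕ → A) j => ω (j + s)) (iidLaw μ) (iidLaw μ) := by
  refine ⟨measurable_shift s, ?_⟩
  have h := (iIndepFun_eval_iidLaw μ).precomp (add_left_injective s)
  have h2 := h.map_fun_eq_infinitePi_map (fun i => by fun_prop)
  refine h2.trans ?_
  simp only [iidLaw, Measure.infinitePi_map_eval]

theorem iidLaw_window_concat_add (μ : ProbabilityMeasure (ℕ → A)) {L : ℕ} (hL : 0 < L)
    (m s k : ℕ) {B : Set (Fin k → A)} (hB : MeasurableSet B) :
    (iidLaw μ).real {ω | window (m + s * L) k (concat L ω) ∈ B}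
      = (iidLaw μ).real {ω | window m k (concat L ω) ∈ B} := by
  simp only [window_concat_add_mul hL]
  exact (measurePreserving_shift_iidLaw μ s).measureReal_preimage
    (((measurable_window m k).comp (measurable_concat L)) hB).nullMeasurableSet

theorem iidLaw_window_concat_of_le (μ : ProbabilityMeasure (ℕ → A)) {L m k : ℕ}
    (h : m + k ≤ L) {B : Set (Fin k → A)} (hB : MeasurableSet B) :
    (iidLaw μ).real {ω | window m k (concat L ω) ∈ B}
      = (μ : Measure (ℕ → A)).real {x | window m k x ∈ B} := by
  have hev := measurePreserving_eval_infinitePi (fun _ : ℕ => (μ : Measure (ℕ → A))) 0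
  have : {ω : ℕ → ℕ → A | window m k (concat L ω) ∈ B}
      = Function.eval 0 ⁻¹' {x : ℕ → A | window m k x ∈ B} := by
    ext ω
    have : window m k (concat L ω) = window m k (ω 0) := by
      funext t
      have ht : m + (t : ℕ) < L := by omega
      simp [window, concat, Nat.div_eq_of_lt ht, Nat.mod_eq_of_lt ht]
    simp [this]
  rw [this]
  exact hev.measureReal_preimage ((measurable_window m k) hB).nullMeasurableSet

/-- The first window reads only blocks before `m' / L`, the second only blocks from `m' / L` on. -/
theorem indepFun_window_concat (μ : ProbabilityMeasure (ℕ → A)) {L : ℕ} {m m' k : ℕ}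
    (h : (m + k) / L < m' / L) :
    ProbabilityTheory.IndepFun (fun ω => window m k (concat L ω))
      (fun ω => window m' k (concat L ω)) (iidLaw μ) := by
  have hmeas : ∀ (S : Set ℕ) (m : ℕ), (∀ t < k, (m + t) / L ∈ S) →
      MeasurableSpace.comap (fun ω : ℕ → ℕ → A => window m k (concat L ω)) inferInstance
        ≤ ⨆ j ∈ S, MeasurableSpace.comap (fun ω : ℕ → ℕ → A => ω j) inferInstance := by
    intro S m hS
    rw [← measurable_iff_comap_le]
    refine @measurable_pi_lambda _ _ _ (_) _ _ fun t => ?_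
    have h1 : Measurable[MeasurableSpace.comap
        (fun ω : ℕ → ℕ → A => ω ((m + (t : ℕ)) / L)) inferInstance]
        (fun ω : ℕ → ℕ → A => ω ((m + (t : ℕ)) / L) ((m + (t : ℕ)) % L)) :=
      (measurable_pi_apply _).comp (comap_measurable _)
    exact h1.mono (le_iSup₂_of_le ((m + (t : ℕ)) / L) (hS t t.2) le_rfl) le_rfl
  have hind := ProbabilityTheory.indep_iSup_of_disjoint
    (fun j => (measurable_pi_apply (X := fun _ : ℕ => ℕ → A) j).comap_le)
    (iIndepFun_eval_iidLaw μ)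
    (S := Set.Iio (m' / L)) (T := Set.Ici (m' / L))
    (Set.disjoint_left.2 fun a ha hb => absurd (Set.mem_Iio.1 ha) (not_lt.2 (Set.mem_Ici.1 hb)))
  refine ProbabilityTheory.indep_of_indep_of_le_left
    (ProbabilityTheory.indep_of_indep_of_le_right hind ?_) ?_
  · exact hmeas _ _ fun t _ => Nat.div_le_div_right (by omega)
  · exact hmeas _ _ fun t ht => lt_of_le_of_lt (Nat.div_le_div_right (by omega)) h

/-- With a stride of `k + 1` whole blocks, successive windows meet disjoint sets of blocks and have
the same law. Pairwise independence is enough for the strong law. -/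
theorem ae_tendsto_average_window_concat (μ : ProbabilityMeasure (ℕ → A)) {L : ℕ} (hL : 0 < L)
    (k : ℕ) {B : Set (Fin k → A)} (hB : MeasurableSet B) (m : ℕ) :
    ∀ᵐ ω ∂(iidLaw μ), Tendsto (fun Q : ℕ => (∑ q ∈ Finset.range Q,
      B.indicator (fun _ => (1 : ℝ)) (window (m + q * ((k + 1) * L)) k (concat L ω))) / (Q : ℝ))
      atTop (𝓝 ((iidLaw μ).real {ω | window m k (concat L ω) ∈ B})) := by
  have hw : ∀ i, Measurable fun ω : ℕ → ℕ → A => window i k (concat L ω) := fun i =>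
    (measurable_window i k).comp (measurable_concat L)
  have hI : Measurable (B.indicator fun _ => (1 : ℝ)) := measurable_const.indicator hB
  have hslln := ProbabilityTheory.strong_law_ae_real (μ := iidLaw μ)
    (fun q ω => B.indicator (fun _ => (1 : ℝ)) (window (m + q * ((k + 1) * L)) k (concat L ω)))
    ?_ ?_ ?_
  · have hint : ∫ ω, B.indicator (fun _ => (1 : ℝ))
        (window (m + 0 * ((k + 1) * L)) k (concat L ω)) ∂(iidLaw μ)
        = (iidLaw μ).real {ω | window m k (concat L ω) ∈ B} := by
      have hset : MeasurableSet {ω : ℕ → ℕ → A | window m k (concat L ω) ∈ B} := hw m hB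
      rw [← integral_indicator_one hset]
      refine integral_congr_ae (Eventually.of_forall fun ω => ?_)
      change B.indicator _ (window (m + 0 * ((k + 1) * L)) k (concat L ω)) = _
      rw [zero_mul, add_zero]
      rfl
    rw [hint] at hslln
    exact hslln
  · refine Integrable.of_bound (hI.comp (hw _)).aestronglyMeasurable 1
      (Eventually.of_forall fun ω => ?_)
    by_cases hx : window (m + 0 * ((k + 1) * L)) k (concat L ω) ∈ B
    · rw [Set.indicator_of_mem hx, norm_one]
    · rw [Set.indicator_of_notMem hx, norm_zero]
      exact zero_le_one
  · have key : ∀ q q' : ℕ, q < q' → ProbabilityTheory.IndepFun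
        (fun ω => B.indicator (fun _ => (1 : ℝ)) (window (m + q * ((k + 1) * L)) k (concat L ω)))
        (fun ω => B.indicator (fun _ => (1 : ℝ)) (window (m + q' * ((k + 1) * L)) k (concat L ω)))
        (iidLaw μ) := by
      intro q q' hq
      refine (indepFun_window_concat μ (m := m + q * ((k + 1) * L))
        (m' := m + q' * ((k + 1) * L)) ?_).comp hI hI
      have hk : k < (k + 1) * L := by nlinarith
      have e1 : m + q' * ((k + 1) * L) = m + q' * (k + 1) * L := by ring
      -- Since `k ≤ k * L`, a window reaches at most `k` blocks beyond its starting one.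
      have e2 : m + q * ((k + 1) * L) + k ≤ m + (q * (k + 1) + k) * L := by nlinarith
      calc (m + q * ((k + 1) * L) + k) / L ≤ (m + (q * (k + 1) + k) * L) / L :=
            Nat.div_le_div_right e2
        _ = m / L + (q * (k + 1) + k) := Nat.add_mul_div_right _ _ hL
        _ < m / L + q' * (k + 1) := by nlinarith
        _ = (m + q' * ((k + 1) * L)) / L := by rw [e1, Nat.add_mul_div_right _ _ hL]
    intro q q' hq
    rcases lt_or_gt_of_ne hq with h | h
    · exact key q q' h
    · exact (key q' q h).symm
  · intro q
    refine ⟨(hI.comp (hw _)).aemeasurable, (hI.comp (hw _)).aemeasurable, ?_⟩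
    have hs := measurePreserving_shift_iidLaw μ (q * (k + 1))
    have e : (fun ω : ℕ → ℕ → A => B.indicator (fun _ => (1 : ℝ))
          (window (m + q * ((k + 1) * L)) k (concat L ω)))
        = (fun ω => B.indicator (fun _ => (1 : ℝ))
            (window (m + 0 * ((k + 1) * L)) k (concat L ω)))
          ∘ (fun (ω : ℕ → ℕ → A) j => ω (j + q * (k + 1))) := by
      funext ω
      simp only [Function.comp, zero_mul, add_zero]
      rw [← window_concat_add_mul hL, mul_assoc]
    have hm : Measurable fun ω : ℕ → ℕ → A => B.indicator (fun _ => (1 : ℝ))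
        (window (m + 0 * ((k + 1) * L)) k (concat L ω)) := hI.comp (hw _)
    rw [e, ← Measure.map_map hm hs.measurable, hs.map_eq]

/-- The process that concatenates independent blocks of length `L` distributed as the initial
segment of `μ`, started at a uniformly random phase. -/
noncomputable def blockMeasure (μ : ProbabilityMeasure (ℕ → A)) (L : ℕ) : Measure (ℕ → A) :=
  (L : ENNReal)⁻¹ • ∑ u ∈ Finset.range L,
    (iidLaw μ).map fun ω j => concat L ω (j + u)

theorem measurable_shift_concat (L u : ℕ) :
    Measurable fun (ω : ℕ → ℕ → A) j => concat L ω (j + u) :=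
  (measurable_shift u).comp (measurable_concat L)

theorem isProbabilityMeasure_blockMeasure (μ : ProbabilityMeasure (ℕ → A)) {L : ℕ} (hL : 0 < L) :
    IsProbabilityMeasure (blockMeasure μ L) := by
  refine ⟨?_⟩
  have : ∀ u, (iidLaw μ).map (fun ω j => concat L ω (j + u)) Set.univ = 1 := fun u => by
    rw [Measure.map_apply (measurable_shift_concat L u) MeasurableSet.univ]
    simp
  simp only [blockMeasure, Measure.smul_apply, Measure.finsetSum_apply, this, smul_eq_mul]
  simp only [Finset.sum_const, Finset.card_range, nsmul_eq_mul, mul_one]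
  exact ENNReal.inv_mul_cancel (by exact_mod_cast hL.ne') (ENNReal.natCast_ne_top L)

theorem blockMeasure_real_window (μ : ProbabilityMeasure (ℕ → A)) (L i k : ℕ)
    {B : Set (Fin k → A)} (hB : MeasurableSet B) :
    (blockMeasure μ L).real {x | window i k x ∈ B}
      = (L : ℝ)⁻¹ * ∑ u ∈ Finset.range L,
        (iidLaw μ).real {ω | window (u + i) k (concat L ω) ∈ B} := by
  have h : ∀ u, (iidLaw μ).map (fun ω j => concat L ω (j + u)) {x | window i k x ∈ B}
      = (iidLaw μ) {ω | window (u + i) k (concat L ω) ∈ B} := fun u => by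
    have hset : MeasurableSet {x : ℕ → A | window i k x ∈ B} := measurable_window i k hB
    rw [Measure.map_apply (measurable_shift_concat L u) hset]
    simp only [Set.preimage_ofPred_eq, window_shift]
  simp only [Measure.real, blockMeasure, Measure.smul_apply, Measure.finsetSum_apply, h,
    smul_eq_mul, ENNReal.toReal_mul, ENNReal.toReal_inv, ENNReal.toReal_natCast]
  rw [ENNReal.toReal_sum fun u _ => measure_ne_top _ _]

/-- `blockMeasure` as a bundled probability measure. -/
noncomputable def blockProcess (μ : ProbabilityMeasure (ℕ → A)) {L : ℕ} (hL : 0 < L) :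
    ProbabilityMeasure (ℕ → A) :=
  ⟨blockMeasure μ L, isProbabilityMeasure_blockMeasure μ hL⟩

/-- Averaging over the phase sums an `L`-periodic function over a full period, so a time shift
changes nothing. -/
theorem isStationary_blockProcess (μ : ProbabilityMeasure (ℕ → A)) {L : ℕ} (hL : 0 < L) :
    IsStationary (blockProcess μ hL) := by
  intro i k B hB
  rw [← measureReal_eq_measureReal_iff]
  change (blockMeasure μ L).real _ = (blockMeasure μ L).real _
  rw [blockMeasure_real_window μ L 0 k hB, blockMeasure_real_window μ L i k hB]
  congr 1
  refine (sum_range_add_eq_of_periodic (L := L)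
    (g := fun m => (iidLaw μ).real {ω | window m k (concat L ω) ∈ B}) (fun m => ?_) i).symm
  simpa using iidLaw_window_concat_add μ hL m 1 k hB

/-- For each phase the frequency tends to the mean of `g` over a period of `(k + 1) * L`. The phase
only translates `g`, so the constant is the same for all phases. -/
theorem isErgodic_blockProcess (μ : ProbabilityMeasure (ℕ → A)) {L : ℕ} (hL : 0 < L) :
    IsErgodic (blockProcess μ hL) := by
  intro k B hB
  obtain ⟨g, hg⟩ : ∃ g : ℕ → ℝ,
      g = fun m => (iidLaw μ).real {ω | window m k (concat L ω) ∈ B} := ⟨_, rfl⟩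
  have hM : 0 < (k + 1) * L := by positivity
  have hper : ∀ m, g (m + (k + 1) * L) = g m := fun m => by
    rw [hg]
    exact iidLaw_window_concat_add μ hL m (k + 1) k hB
  refine ⟨(∑ m ∈ Finset.range ((k + 1) * L), g m) / ((k + 1) * L : ℕ), ?_⟩
  change ∀ᵐ x ∂(blockMeasure μ L), _
  refine Measure.ae_smul_measure ?_ _
  rw [ae_finsetSum_measure_iff]
  intro u _
  have hall : ∀ᵐ ω ∂(iidLaw μ), ∀ m : ℕ, Tendsto (fun Q : ℕ => (∑ q ∈ Finset.range Q,
      B.indicator (fun _ => (1 : ℝ)) (window (m + q * ((k + 1) * L)) k (concat L ω))) / (Q : ℝ))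
      atTop (𝓝 (g m)) :=
    hg ▸ ae_all_iff.2 fun m => ae_tendsto_average_window_concat μ hL k hB m
  have hI : Measurable (B.indicator fun _ => (1 : ℝ)) := measurable_const.indicator hB
  have havg : ∀ᵐ x ∂(iidLaw μ).map (fun ω j => concat L ω (j + u)),
      Tendsto (fun N : ℕ => (∑ i ∈ Finset.range N,
        B.indicator (fun _ => (1 : ℝ)) (window i k x)) / (N : ℝ)) atTop
        (𝓝 ((∑ m ∈ Finset.range ((k + 1) * L), g m) / ((k + 1) * L : ℕ))) := by
    rw [ae_map_iff (measurable_shift_concat L u).aemeasurable]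
    · filter_upwards [hall] with ω hω
      rw [← sum_range_add_eq_of_periodic hper u]
      refine tendsto_average_of_residues (fun i => Set.indicator_nonneg (fun _ _ => zero_le_one) _)
        (fun i => Set.indicator_le' (fun _ _ => le_rfl) (fun _ _ => zero_le_one) _) hM fun m _ => ?_
      simp only [window_shift]
      refine (hω (m + u)).congr fun Q => ?_
      congr 1
      exact Finset.sum_congr rfl fun q _ => by rw [add_comm m u, add_assoc]
    · exact measurableSet_tendsto _ fun N =>
        (Finset.measurable_sum _ fun i _ => hI.comp (measurable_window i k)).div_const _
  filter_upwards [havg] with x hx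
  have hlim : Tendsto (fun n : ℕ => n - k + 1) atTop atTop :=
    tendsto_atTop_mono (fun n => by omega) (tendsto_sub_atTop_nat k)
  refine (hx.comp hlim).congr' ?_
  filter_upwards [eventually_ge_atTop k] with n hn
  rw [freq_window x hn]
  rfl

/-- At least `L - k` of the `L` phases put the window inside a single block, where stationarity
gives it the law under `μ`; the other phases are discarded. -/
theorem blockProcess_real_window_ge {μ : ProbabilityMeasure (ℕ → A)} (hμ : IsStationary μ) {L : ℕ}
    (hL : 0 < L) (k : ℕ) {B : Set (Fin k → A)} (hB : MeasurableSet B) :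
    (1 - min 1 ((k : ℝ) / L)) * (μ : Measure (ℕ → A)).real {x | window 0 k x ∈ B}
      ≤ (blockProcess μ hL : Measure (ℕ → A)).real {x | window 0 k x ∈ B} := by
  rcases le_total L k with h | h
  · have : (1 : ℝ) ≤ (k : ℝ) / L := by
      rw [one_le_div (by exact_mod_cast hL)]
      exact_mod_cast h
    rw [min_eq_left this, sub_self, zero_mul]
    exact measureReal_nonneg
  · have hLR : (0 : ℝ) < L := by exact_mod_cast hL
    have hkL : (k : ℝ) ≤ L := by exact_mod_cast h
    rw [min_eq_right ((div_le_one hLR).2 hkL)]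
    change _ ≤ (blockMeasure μ L).real _
    rw [blockMeasure_real_window μ L 0 k hB]
    have hterm : ∀ u ∈ Finset.range (L - k),
        (iidLaw μ).real {ω | window (u + 0) k (concat L ω) ∈ B}
          = (μ : Measure (ℕ → A)).real {x | window 0 k x ∈ B} := fun u hu => by
      have hu' := Finset.mem_range.1 hu
      rw [iidLaw_window_concat_of_le μ (by omega) hB, measureReal_def, measureReal_def, hμ _ _ _ hB]
    calc (1 - (k : ℝ) / L) * (μ : Measure (ℕ → A)).real {x | window 0 k x ∈ B}
        = (L : ℝ)⁻¹ * ∑ u ∈ Finset.range (L - k),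
          (iidLaw μ).real {ω | window (u + 0) k (concat L ω) ∈ B} := by
          rw [Finset.sum_congr rfl hterm, Finset.sum_const, Finset.card_range, nsmul_eq_mul,
            Nat.cast_sub h]
          field_simp
      _ ≤ _ := by
          refine mul_le_mul_of_nonneg_left ?_ (by positivity)
          exact Finset.sum_le_sum_of_subset_of_nonneg
            (Finset.range_mono (Nat.sub_le L k)) fun _ _ _ => measureReal_nonneg

end BlockProcess

/-! ### Ergodic processes near `ν` that dominate a fraction of `ρ`. -/

section Approximation

variable {A : Type*} [MeasurableSpace A]

theorem exists_mixture {ν ρ : ProbabilityMeasure (ℕ → A)} (hν : IsStationary ν)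
    (hρ : IsStationary ρ) {δ : ℝ} (h0 : 0 ≤ δ) (h1 : δ ≤ 1) :
    ∃ μ : ProbabilityMeasure (ℕ → A), IsStationary μ ∧ ∀ S : Set (ℕ → A),
      (μ : Measure (ℕ → A)).real S
        = (1 - δ) * (ν : Measure (ℕ → A)).real S + δ * (ρ : Measure (ℕ → A)).real S := by
  refine ⟨⟨ENNReal.ofReal (1 - δ) • (ν : Measure (ℕ → A))
    + ENNReal.ofReal δ • (ρ : Measure (ℕ → A)), ⟨?_⟩⟩, ?_, fun S => ?_⟩
  · simp [← ENNReal.ofReal_add (sub_nonneg.2 h1) h0]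
  · intro i k B hB
    simp [hν i k B hB, hρ i k B hB]
  · simp only [ProbabilityMeasure.coe_mk]
    have hfin : ∀ (c : ℝ) (κ : ProbabilityMeasure (ℕ → A)),
        (ENNReal.ofReal c • (κ : Measure (ℕ → A))) S ≠ ⊤ := fun c κ =>
      ENNReal.mul_ne_top ENNReal.ofReal_ne_top (measure_ne_top _ _)
    rw [measureReal_add_apply (hfin _ _) (hfin _ _), measureReal_ennreal_smul_apply, measureReal_ennreal_smul_apply,
      ENNReal.toReal_ofReal (sub_nonneg.2 h1), ENNReal.toReal_ofReal h0]

variable [Fintype A]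

theorem sum_real_window_eq [MeasurableSingletonClass A] (μ : ProbabilityMeasure (ℕ → A)) (k : ℕ) :
    ∑ w : Fin k → A, (μ : Measure (ℕ → A)).real {x | window 0 k x = w} = 1 := by
  have h := sum_measureReal_preimage_singleton (μ := (μ : Measure (ℕ → A))) Finset.univ
    (f := window 0 k) fun w _ => measurable_window 0 k (measurableSet_singleton w)
  simpa [Set.preimage] using h

/-- A one-sided bound suffices because both laws have total mass one: `c * b ≤ a` and `c ≤ 1` give
`|a - b| ≤ a + (1 - 2 * c) * b` for `b ≥ 0`. -/
theorem wordDist_le [MeasurableSingletonClass A] {p q : ProbabilityMeasure (ℕ → A)} {k : ℕ} {c : ℝ} (hc : c ≤ 1)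
    (h : ∀ w : Fin k → A, c * (q : Measure (ℕ → A)).real {x | window 0 k x = w}
      ≤ (p : Measure (ℕ → A)).real {x | window 0 k x = w}) :
    wordDist p q k ≤ 2 * (1 - c) := by
  calc wordDist p q k
      ≤ ∑ w : Fin k → A, ((p : Measure (ℕ → A)).real {x | window 0 k x = w}
        + (1 - 2 * c) * (q : Measure (ℕ → A)).real {x | window 0 k x = w}) := by
        refine Finset.sum_le_sum fun w _ => ?_
        have hq : 0 ≤ (q : Measure (ℕ → A)).real {x | window 0 k x = w} := measureReal_nonneg
        have := h w
        rw [abs_le]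
        constructor <;> nlinarith
    _ = 2 * (1 - c) := by
        rw [Finset.sum_add_distrib, ← Finset.mul_sum, sum_real_window_eq, sum_real_window_eq]
        ring

theorem summable_weights : Summable fun j : ℕ => 1 / (((j : ℝ) + 1) * ((j : ℝ) + 2)) := by
  have h := (summable_nat_add_iff 1).2 (Real.summable_one_div_nat_pow.2 one_lt_two)
  refine Summable.of_nonneg_of_le (fun j => by positivity) (fun j => ?_) h
  push_cast
  gcongr
  nlinarith

theorem tendsto_tsum_weights_mul_min :
    Tendsto (fun L : ℕ => ∑' j : ℕ, 1 / (((j : ℝ) + 1) * ((j : ℝ) + 2)) *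
      min 1 (((j + 1 : ℕ) : ℝ) / L)) atTop (𝓝 0) := by
  have h := tendsto_tsum_of_dominated_convergence (𝓕 := atTop)
    (f := fun (L j : ℕ) => 1 / (((j : ℝ) + 1) * ((j : ℝ) + 2)) * min 1 (((j + 1 : ℕ) : ℝ) / L))
    (g := fun _ => (0 : ℝ)) summable_weights (fun j => ?_) (Eventually.of_forall fun L j => ?_)
  · simpa using h
  · have h1 : Tendsto (fun L : ℕ => min 1 (((j + 1 : ℕ) : ℝ) / L)) atTop (𝓝 (min 1 0)) :=
      tendsto_const_nhds.min (tendsto_const_div_atTop_nhds_zero_nat _)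
    simpa using h1.const_mul (1 / (((j : ℝ) + 1) * ((j : ℝ) + 2)))
  · have h0 : (0 : ℝ) ≤ min 1 (((j + 1 : ℕ) : ℝ) / L) := le_min zero_le_one (by positivity)
    rw [Real.norm_of_nonneg (by positivity)]
    exact mul_le_of_le_one_right (by positivity) (min_le_left _ _)

theorem summable_weights_mul_min (L : ℕ) : Summable fun j : ℕ =>
    1 / (((j : ℝ) + 1) * ((j : ℝ) + 2)) * min 1 (((j + 1 : ℕ) : ℝ) / L) :=
  Summable.of_nonneg_of_le
    (fun j => mul_nonneg (by positivity) (le_min zero_le_one (by positivity)))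
    (fun j => mul_le_of_le_one_right (by positivity) (min_le_left _ _)) summable_weights

theorem distDistance_le {p q : ProbabilityMeasure (ℕ → A)} {δ : ℝ} {L : ℕ}
    (h : ∀ k, wordDist p q k ≤ 2 * (δ + min 1 ((k : ℝ) / L))) :
    distDistance p q ≤ 2 * δ * (∑' j : ℕ, 1 / (((j : ℝ) + 1) * ((j : ℝ) + 2))) +
      2 * ∑' j : ℕ, 1 / (((j : ℝ) + 1) * ((j : ℝ) + 2)) * min 1 (((j + 1 : ℕ) : ℝ) / L) := by
  rw [← tsum_mul_left, ← tsum_mul_left, ← (summable_weights.mul_left _).tsum_add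
    ((summable_weights_mul_min L).mul_left 2)]
  have hle : ∀ j : ℕ, 1 / (((j : ℝ) + 1) * ((j : ℝ) + 2)) * wordDist p q (j + 1)
      ≤ 2 * δ * (1 / (((j : ℝ) + 1) * ((j : ℝ) + 2))) +
        2 * (1 / (((j : ℝ) + 1) * ((j : ℝ) + 2)) * min 1 (((j + 1 : ℕ) : ℝ) / L)) := fun j => by
    refine (mul_le_mul_of_nonneg_left (h (j + 1)) (by positivity)).trans_eq ?_
    ring
  have hsum := (summable_weights.mul_left (2 * δ)).add ((summable_weights_mul_min L).mul_left 2)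
  refine Summable.tsum_le_tsum hle (Summable.of_nonneg_of_le (fun j => ?_) hle hsum) hsum
  exact mul_nonneg (by positivity) (Finset.sum_nonneg fun _ _ => abs_nonneg _)

/-- Near every stationary process `ν` there are stationary ergodic processes that give to every
event about the first `n` letters at least a fixed fraction of its `ρ`-probability; the fraction
depends on the distance to `ν` only. -/
theorem exists_ergodic_near [MeasurableSingletonClass A] {ρ ν : ProbabilityMeasure (ℕ → A)}
    (hρ : IsStationary ρ) (hν : IsStationary ν) {ε : ℝ} (hε : 0 < ε) :
    ∃ δ : ℝ, 0 < δ ∧ ∀ n : ℕ, ∃ p ∈ stationaryErgodic A, distDistance p ν ≤ ε ∧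
      ∀ S : Set (Fin n → A), δ * (ρ : Measure (ℕ → A)).real {x | window 0 n x ∈ S}
        ≤ (p : Measure (ℕ → A)).real {x | window 0 n x ∈ S} := by
  set K : ℝ := ∑' j : ℕ, 1 / (((j : ℝ) + 1) * ((j : ℝ) + 2)) with hK
  have hK0 : 0 ≤ K := tsum_nonneg fun j => by positivity
  -- The mixture may spend `ε / 2` of the distance. This choice precedes `n`, which is what makes
  -- the fraction uniform.
  set δ : ℝ := min 1 (ε / (4 * (K + 1))) with hδ
  have hδ0 : 0 < δ := lt_min one_pos (by positivity)
  have hδ1 : δ ≤ 1 := min_le_left _ _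
  have hδK : 2 * δ * K ≤ ε / 2 := by
    have h : δ * (4 * (K + 1)) ≤ ε := (le_div_iff₀ (by positivity)).1 (min_le_right _ _)
    nlinarith
  refine ⟨δ / 2, half_pos hδ0, fun n => ?_⟩
  obtain ⟨μ, hμ, hμS⟩ := exists_mixture hν hρ hδ0.le hδ1
  -- The blocks spend the other `ε / 2`; `L ≥ 2 * n + 1` makes them lose at most half of the
  -- fraction `δ`.
  obtain ⟨L, hLε, hLn⟩ := ((tendsto_tsum_weights_mul_min.eventually_le_const
    (show (0 : ℝ) < ε / 4 by positivity)).and (eventually_ge_atTop (2 * n + 1))).exists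
  have hL : 0 < L := by omega
  have hmeas : ∀ {k : ℕ} (S : Set (Fin k → A)), MeasurableSet S := fun S => S.toFinite.measurableSet
  refine ⟨blockProcess μ hL, ⟨isStationary_blockProcess μ hL, isErgodic_blockProcess μ hL⟩, ?_,
    fun S => ?_⟩
  · have hword : ∀ k, wordDist (blockProcess μ hL) ν k ≤ 2 * (δ + min 1 ((k : ℝ) / L)) := fun k => by
      set t : ℝ := min 1 ((k : ℝ) / L) with ht
      have ht1 : t ≤ 1 := min_le_left _ _
      have ht0 : 0 ≤ t := le_min zero_le_one (by positivity)
      refine (wordDist_le (c := (1 - t) * (1 - δ)) (by nlinarith) fun w => ?_).trans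
        (by nlinarith)
      have h := blockProcess_real_window_ge hμ hL k (hmeas {w})
      simp only [Set.mem_singleton_iff, hμS] at h
      refine le_trans ?_ h
      rw [mul_assoc]
      refine mul_le_mul_of_nonneg_left (le_add_of_nonneg_right ?_) (by linarith)
      exact mul_nonneg hδ0.le measureReal_nonneg
    have h := distDistance_le hword
    linarith
  · refine le_trans ?_ (blockProcess_real_window_ge hμ hL n (hmeas S))
    rw [hμS]
    have hLR : (0 : ℝ) < L := by exact_mod_cast hL
    have hnL : 2 * (n : ℝ) + 1 ≤ L := by exact_mod_cast hLn
    have ht : min 1 ((n : ℝ) / L) ≤ 1 / 2 := by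
      refine (min_le_right _ _).trans ?_
      rw [div_le_iff₀ hLR]
      linarith
    have hρS : 0 ≤ (ρ : Measure (ℕ → A)).real {x | window 0 n x ∈ S} := measureReal_nonneg
    have hνS : 0 ≤ (1 - δ) * (ν : Measure (ℕ → A)).real {x | window 0 n x ∈ S} :=
      mul_nonneg (by linarith) measureReal_nonneg
    have hδρ := mul_nonneg hδ0.le hρS
    nlinarith

end Approximation

end StationaryProcess

theorem mainTheorem11 {A : Type*} [Fintype A] [MeasurableSpace A] [MeasurableSingletonClass A]
    (ρ ν : ProbabilityMeasure (ℕ → A))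
    (hρ : ρ ∈ StationaryProcess.stationaryErgodic A)
    (hν : ν ∈ StationaryProcess.stationaryErgodic A)
    (hne : ρ ≠ ν) (ε : ℝ) (hε : 0 < ε) :
    ¬ ∃ φ : StationaryProcess.Test A,
      StationaryProcess.UniformlyConsistent φ {ρ}
        {ν' | ν' ∈ StationaryProcess.stationaryErgodic A ∧
          StationaryProcess.distDistance ν' ν ≤ ε} := by
  rintro ⟨φ, hφ⟩
  obtain ⟨δ, hδ, hnear⟩ := StationaryProcess.exists_ergodic_near hρ.1 hν.1 hε
  -- Under `ρ` the answer `0` then has probability above `1/2`, hence above `δ / 2` under `p`, where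
  -- it must be below `δ / 2`.
  obtain ⟨N, hN⟩ := hφ (min (1 / 2) (δ / 2)) (lt_min (by norm_num) (by positivity))
  obtain ⟨p, hp, hpν, hpS⟩ := hnear N
  have h0 := (hN N le_rfl).1 ρ rfl
  have h1 := (hN N le_rfl).2 p ⟨hp, hpν⟩
  have h2 := hpS {w | φ N w = 0}
  simp only [Set.mem_ofPred_eq] at h2
  have hset : MeasurableSet {x : ℕ → A | φ N (StationaryProcess.window 0 N x) = 1} :=
    StationaryProcess.measurable_window 0 N (Set.toFinite {w | φ N w = 1}).measurableSet
  have hcompl : {x : ℕ → A | φ N (StationaryProcess.window 0 N x) = 0}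
      = {x : ℕ → A | φ N (StationaryProcess.window 0 N x) = 1}ᶜ := by
    ext x
    simp only [Set.mem_ofPred_eq, Set.mem_compl_iff]
    omega
  rw [hcompl, probReal_compl_eq_one_sub hset, ← hcompl] at h2
  have h3 := h0.trans_le (min_le_left _ _)
  have h4 := h1.trans_le (min_le_right _ _)
  nlinarith
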